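/- All rings are associative with $1\neq 0$. A unary pp formula for left $R$-modules is a formula $\varphi(x)=\exists\,\bar y\,(\mathfrak A\bar y=\mathfrak b x)$ with finite matrices $\mathfrak A,\mathfrak b$ over $R$; $\varphi(M)$ denotes the set of its solutions in a module $M$. A module is absolutely pure if it is a pure submodule of every module containing it. The formula $\varphi$ is called high if $\varphi(N)=N$ for every absolutely pure module $N$, low if $\varphi(F)=0$ for every flat module $F$, and high-low if it is both; likewise for right pp formulas and right modules. To say that $R$ has no high-low formula means that no unary pp formula, left or right, is high-low over $R$. An extension of right $R$-modules $A\subseteq B$ is rational if for all $b_0,b_1\in B$ with $b_1\neq 0$ there is $s\in R$ with $b_1s\neq 0$ and $b_0s\in A$. A module is nonsingular if no annihilator of a nonzero element is an essential one-sided ideal, and $R$ is right nonsingular if $R_R$ is nonsingular. For right nonsingular $R$, the maximal right quotient ring of $R$ is the ring extension $Q\supseteq R$ for which $Q_R$ is an injective hull of $R_R$. 1. Let $R\subseteq Q$ be a ring extension such that $R_R\subseteq Q_R$ is rational, and suppose that the left $R$-module ${}_RQ$ is absolutely pure. Then $R$ has no high-low formula. 2. In particular, let $R$ be right nonsingular with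 maximal right quotient ring $Q$, and suppose that ${}_RQ$ is absolutely pure. Then $R$ has no high-low formula. 3. In particular, no nonzero commutative nonsingular ring has a high-low formula. -/

import Mathlib

open scoped MulOpposite TensorProduct

universe u v w

/-! Right modules over a ring `R` are modules over `Rᵐᵒᵖ`, with `x r` written `MulOpposite.op r • x`. -/

section Formulas

/-- An `n`-place pp formula `∃ y (A y = B x)` for left `R`-modules, given by its matrices.
A right pp formula `∃ y (y C = x D)` over `R` is a `PPFormula Rᵐᵒᵖ n`. -/
structure PPFormula (R : Type u) (n : ℕ) where
  rows : ℕ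
  bound : ℕ
  A : Matrix (Fin rows) (Fin bound) R
  B : Matrix (Fin rows) (Fin n) R

/-- The tuple `x` satisfies the formula in the module containing it. -/
def PPFormula.Realize {R : Type u} [Ring R] {M : Type v} [AddCommGroup M] [Module R M] {n : ℕ}
    (φ : PPFormula R n) (x : Fin n → M) : Prop :=
  ∃ y : Fin φ.bound → M, ∀ i, ∑ j, φ.A i j • y j = ∑ j, φ.B i j • x j

/-- The subset `φ(M)` of `M` defined by a unary pp formula. -/
def PPFormula.solutions {R : Type u} [Ring R] (φ : PPFormula R 1)
    (M : Type v) [AddCommGroup M] [Module R M] : Set M :=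
  {a | φ.Realize (fun _ : Fin 1 => a)}

end Formulas

section Purity

/-- A pure embedding of left modules: pp formulas that hold in `N` of a tuple from `M`
already hold in `M`. -/
def IsPureEmbedding {R : Type u} [Ring R] {M : Type v} {N : Type w} [AddCommGroup M] [Module R M]
    [AddCommGroup N] [Module R N] (f : M →ₗ[R] N) : Prop :=
  Function.Injective f ∧
    ∀ (n : ℕ) (φ : PPFormula R n) (x : Fin n → M), φ.Realize (fun i => f (x i)) → φ.Realize x

/-- A module is absolutely pure if it is pure in every module that contains it. -/
def IsAbsolutelyPure (R : Type u) [Ring R] (M : Type u) [AddCommGroup M] [Module R M] : Prop :=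
  ∀ (N : Type u) [AddCommGroup N] [Module R N] (f : M →ₗ[R] N),
    Function.Injective f → IsPureEmbedding f

end Purity

section Flatness

/-- The relations `x r ⊗ m = x ⊗ r m`. -/
def balancedRelations (R : Type u) [Ring R] (X : Type v) (M : Type w)
    [AddCommGroup X] [Module Rᵐᵒᵖ X] [AddCommGroup M] [Module R M] : AddSubgroup (X ⊗[ℤ] M) :=
  AddSubgroup.closure
    {t | ∃ (x : X) (r : R) (m : M), t = (MulOpposite.op r • x) ⊗ₜ[ℤ] m - x ⊗ₜ[ℤ] (r • m)}

/-- The tensor product `X ⊗_R M` of a right module `X` and a left module `M` over an arbitrary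
ring `R`, as an abelian group. -/
abbrev BalancedTensor (R : Type u) [Ring R] (X : Type v) (M : Type w)
    [AddCommGroup X] [Module Rᵐᵒᵖ X] [AddCommGroup M] [Module R M] : Type (max v w) :=
  (X ⊗[ℤ] M) ⧸ balancedRelations R X M

theorem balancedRelations_le_comap (R : Type u) [Ring R] {X Y : Type v} (M : Type w)
    [AddCommGroup X] [Module Rᵐᵒᵖ X] [AddCommGroup Y] [Module Rᵐᵒᵖ Y] [AddCommGroup M] [Module R M]
    (f : X →ₗ[Rᵐᵒᵖ] Y) :
    balancedRelations R X M ≤ (balancedRelations R Y M).comap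
      (LinearMap.rTensor M f.toAddMonoidHom.toIntLinearMap).toAddMonoidHom := by
  refine (AddSubgroup.closure_le _).2 ?_
  rintro _ ⟨x, r, m, rfl⟩
  refine AddSubgroup.subset_closure ⟨f x, r, m, ?_⟩
  simp

/-- The map `f ⊗ M : X ⊗_R M → Y ⊗_R M`. -/
def BalancedTensor.map (R : Type u) [Ring R] {X Y : Type v} (M : Type w)
    [AddCommGroup X] [Module Rᵐᵒᵖ X] [AddCommGroup Y] [Module Rᵐᵒᵖ Y] [AddCommGroup M] [Module R M]
    (f : X →ₗ[Rᵐᵒᵖ] Y) : BalancedTensor R X M →+ BalancedTensor R Y M :=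
  QuotientAddGroup.map _ _ (LinearMap.rTensor M f.toAddMonoidHom.toIntLinearMap).toAddMonoidHom
    (balancedRelations_le_comap R M f)

/-- A left module is flat if tensoring with it preserves injectivity of maps of right modules. -/
def IsFlatModule (R : Type u) [Ring R] (M : Type u) [AddCommGroup M] [Module R M] : Prop :=
  ∀ (X Y : Type u) [AddCommGroup X] [Module Rᵐᵒᵖ X] [AddCommGroup Y] [Module Rᵐᵒᵖ Y]
    (f : X →ₗ[Rᵐᵒᵖ] Y), Function.Injective f → Function.Injective (BalancedTensor.map R M f)

end Flatness

section HighLow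

/-- A unary pp formula is high if `φ(N) = N` for every absolutely pure module `N`. -/
def PPFormula.IsHigh {R : Type u} [Ring R] (φ : PPFormula R 1) : Prop :=
  ∀ (N : Type u) [AddCommGroup N] [Module R N], IsAbsolutelyPure R N →
    φ.solutions N = Set.univ

/-- A unary pp formula is low if `φ(F) = 0` for every flat module `F`. -/
def PPFormula.IsLow {R : Type u} [Ring R] (φ : PPFormula R 1) : Prop :=
  ∀ (F : Type u) [AddCommGroup F] [Module R F], IsFlatModule R F →
    φ.solutions F = {0}

/-- Both high and low. -/
def PPFormula.IsHighLow {R : Type u} [Ring R] (φ : PPFormula R 1) : Prop :=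
  φ.IsHigh ∧ φ.IsLow

/-- `R` has no high-low unary pp formula, neither for left nor for right modules. -/
def HasNoHighLowFormula (R : Type u) [Ring R] : Prop :=
  (∀ φ : PPFormula R 1, ¬ φ.IsHighLow) ∧ (∀ ψ : PPFormula Rᵐᵒᵖ 1, ¬ ψ.IsHighLow)

end HighLow

section Quotients

/-- A submodule that meets every nonzero submodule nontrivially. -/
def IsEssentialSubmodule {S : Type u} [Ring S] {M : Type v} [AddCommGroup M] [Module S M]
    (N : Submodule S M) : Prop :=
  ∀ K : Submodule S M, N ⊓ K = ⊥ → K = ⊥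

/-- A module is nonsingular if no annihilator of a nonzero element is an essential ideal. -/
def IsNonsingularModule (S : Type u) [Ring S] (M : Type v) [AddCommGroup M] [Module S M] : Prop :=
  ∀ m : M, m ≠ 0 → ¬ IsEssentialSubmodule (Ideal.torsionOf S M m)

/-- `R` is right nonsingular if the right module `R_R` is nonsingular. -/
def IsRightNonsingular (R : Type u) [Ring R] : Prop :=
  IsNonsingularModule Rᵐᵒᵖ R

/-- A rational (dense) extension `A ⊆ B` of right `R`-modules, given by an embedding. -/
def IsRationalExtension {R : Type u} [Ring R] {A : Type v} {B : Type w} [AddCommGroup A]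
    [Module Rᵐᵒᵖ A] [AddCommGroup B] [Module Rᵐᵒᵖ B] (f : A →ₗ[Rᵐᵒᵖ] B) : Prop :=
  Function.Injective f ∧
    ∀ b₀ b₁ : B, b₁ ≠ 0 →
      ∃ s : R, MulOpposite.op s • b₁ ≠ 0 ∧ MulOpposite.op s • b₀ ∈ LinearMap.range f

/-- An embedding `f : A → E` that makes `E` an injective hull of `A`. -/
def IsInjectiveHull {S : Type u} [Ring S] {A E : Type u} [AddCommGroup A] [Module S A]
    [AddCommGroup E] [Module S E] (f : A →ₗ[S] E) : Prop :=
  Function.Injective f ∧ IsEssentialSubmodule (LinearMap.range f) ∧ Module.Injective S E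

/-- The additive group of `Q`, as a left and a right `R`-module via `f : R → Q`. -/
def RestrictAlong {R : Type u} {Q : Type v} [Ring R] [Ring Q] (_f : R →+* Q) : Type v := Q

instance RestrictAlong.instAddCommGroup {R : Type u} {Q : Type v} [Ring R] [Ring Q] (f : R →+* Q) :
    AddCommGroup (RestrictAlong f) :=
  inferInstanceAs (AddCommGroup Q)

/-- `_RQ`, with `r • q = f r * q`. -/
instance RestrictAlong.instModuleLeft {R : Type u} {Q : Type v} [Ring R] [Ring Q] (f : R →+* Q) :
    Module R (RestrictAlong f) :=
  Module.compHom Q f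

/-- `Q_R`, with `op r • q = q * f r`. -/
instance RestrictAlong.instModuleRight {R : Type u} {Q : Type v} [Ring R] [Ring Q] (f : R →+* Q) :
    Module Rᵐᵒᵖ (RestrictAlong f) :=
  Module.compHom Q f.op

/-- The ring homomorphism `f`, as a map of right modules `R_R → Q_R`. -/
def RestrictAlong.rightMap {R : Type u} {Q : Type v} [Ring R] [Ring Q] (f : R →+* Q) :
    R →ₗ[Rᵐᵒᵖ] RestrictAlong f where
  toFun := f
  map_add' := f.map_add
  map_smul' s r := f.map_mul r s.unop

/-- For a right nonsingular ring `R`: `f` makes `Q` the maximal right quotient ring of `R`,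
that is, a ring extension whose underlying right `R`-module is the injective hull of `R_R`. -/
def IsMaximalRightQuotientRing {R Q : Type u} [Ring R] [Ring Q] (f : R →+* Q) : Prop :=
  IsInjectiveHull (RestrictAlong.rightMap f)

end Quotients

/-! ### Solutions of pp formulas -/

/-! If a left formula `φ` is high-low, then `1` satisfies it in the absolutely pure module `Q`.
Rationality gives the witnesses a common right denominator `s ≠ 0`, so `s ∈ φ(R)`; but `φ(R) = 0`
because `R` is flat. A right formula `ψ` is replaced by its elementary dual: `ψ` high makes `ψ.dual`
vanish on `R`, `ψ` low makes it hold everywhere on absolutely pure left modules, and the same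
argument applies.

For a nonsingular ring, essentiality of `R` in `Q` already gives rationality. A commutative
nonsingular ring is reduced, and there its localization at a minimal prime `p`, an absolutely pure
field, takes the role of `Q`: clearing denominators puts an element outside `p` into `φ(R) = 0`. -/

theorem PPFormula.mem_solutions_iff {R : Type u} [Ring R] (φ : PPFormula R 1) {M : Type v}
    [AddCommGroup M] [Module R M] {a : M} :
    a ∈ φ.solutions M ↔ ∃ y : Fin φ.bound → M, ∀ i, ∑ j, φ.A i j • y j = φ.B i 0 • a := by
  simp [PPFormula.solutions, PPFormula.Realize]

theorem PPFormula.Realize.map {R : Type u} [Ring R] {M : Type v} {N : Type w} [AddCommGroup M]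
    [Module R M] [AddCommGroup N] [Module R N] (f : M →ₗ[R] N) {n : ℕ} {φ : PPFormula R n}
    {x : Fin n → M} (h : φ.Realize x) : φ.Realize (fun i => f (x i)) := by
  obtain ⟨y, hy⟩ := h
  exact ⟨fun j => f (y j), fun i => by simpa using congrArg f (hy i)⟩

/-- A map with a retraction is a pure embedding. -/
theorem IsPureEmbedding.of_leftInverse {R : Type u} [Ring R] {M : Type v} {N : Type w}
    [AddCommGroup M] [Module R M] [AddCommGroup N] [Module R N] (f : M →ₗ[R] N) (g : N →ₗ[R] M)
    (h : ∀ x, g (f x) = x) : IsPureEmbedding f := by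
  refine ⟨Function.LeftInverse.injective h, fun n φ x hx => ?_⟩
  simpa [h] using hx.map g

theorem Module.Injective.isAbsolutelyPure (R : Type u) [Ring R] (M : Type u) [AddCommGroup M]
    [Module R M] (hM : Module.Injective R M) : IsAbsolutelyPure R M := by
  intro N _ _ f hf
  obtain ⟨g, hg⟩ := hM.out f hf LinearMap.id
  exact .of_leftInverse f g hg

/-- Every module embeds in an injective module. -/
theorem Module.exists_injective_embedding (R : Type u) [Ring R] (M : Type u) [AddCommGroup M]
    [Module R M] : ∃ (E : Type u) (_ : AddCommGroup E) (_ : Module R E) (i : M →ₗ[R] E),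
      Function.Injective i ∧ Module.Injective R E := by
  obtain ⟨⟨J, hJ, i, hi⟩⟩ := CategoryTheory.EnoughInjectives.presentation (ModuleCat.of R M)
  exact ⟨J, inferInstance, inferInstance, i.hom, (ModuleCat.mono_iff_injective i).1 hi,
    (Module.injective_iff_injective_object R J).2 hJ⟩

/-! ### The regular module is flat -/

/-- The canonical map `X ⊗ R → X`. -/
def BalancedTensor.rid (R : Type u) [Ring R] (X : Type v) [AddCommGroup X] [Module Rᵐᵒᵖ X] :
    BalancedTensor R X R →+ X :=
  QuotientAddGroup.lift _
    (TensorProduct.liftAddHom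
      { toFun := fun x =>
          { toFun := fun r => MulOpposite.op r • x
            map_zero' := by simp
            map_add' := fun r s => by simp [add_smul] }
        map_zero' := by ext; simp
        map_add' := fun x y => by ext; simp }
      (fun n x r => by
        change MulOpposite.op r • (n • x) = MulOpposite.op (n • r) • x
        rw [MulOpposite.op_smul, smul_assoc, smul_comm]))
    (by
      refine (AddSubgroup.closure_le _).2 ?_
      rintro _ ⟨x, r, m, rfl⟩
      change _ = _
      simp [TensorProduct.liftAddHom_tmul, mul_smul])

theorem BalancedTensor.rid_mk_tmul (R : Type u) [Ring R] (X : Type v) [AddCommGroup X]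
    [Module Rᵐᵒᵖ X] (x : X) (r : R) :
    BalancedTensor.rid R X (QuotientAddGroup.mk (x ⊗ₜ[ℤ] r)) = MulOpposite.op r • x :=
  rfl

theorem BalancedTensor.mk_rid_tmul_one (R : Type u) [Ring R] (X : Type v) [AddCommGroup X]
    [Module Rᵐᵒᵖ X] (t : BalancedTensor R X R) :
    QuotientAddGroup.mk (BalancedTensor.rid R X t ⊗ₜ[ℤ] (1 : R)) = t := by
  induction t using QuotientAddGroup.induction_on with
  | H t =>
    induction t with
    | zero => simp
    | tmul x r =>
      rw [BalancedTensor.rid_mk_tmul, QuotientAddGroup.eq_iff_sub_mem]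
      exact AddSubgroup.subset_closure ⟨x, r, 1, by simp⟩
    | add s t hs ht =>
      rw [QuotientAddGroup.mk_add, map_add, TensorProduct.add_tmul, QuotientAddGroup.mk_add,
        hs, ht]

theorem BalancedTensor.rid_map (R : Type u) [Ring R] {X Y : Type v} [AddCommGroup X]
    [Module Rᵐᵒᵖ X] [AddCommGroup Y] [Module Rᵐᵒᵖ Y] (f : X →ₗ[Rᵐᵒᵖ] Y)
    (t : BalancedTensor R X R) :
    BalancedTensor.rid R Y (BalancedTensor.map R R f t) = f (BalancedTensor.rid R X t) := by
  rw [← BalancedTensor.mk_rid_tmul_one R X t]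
  change BalancedTensor.rid R Y (QuotientAddGroup.mk (f _ ⊗ₜ[ℤ] (1 : R))) = _
  simp [BalancedTensor.rid_mk_tmul]

/-- `BalancedTensor.rid` is natural with inverse `x ↦ x ⊗ 1`, so it identifies `f ⊗ R` with `f`. -/
theorem isFlatModule_self (R : Type u) [Ring R] : IsFlatModule R R := by
  intro X Y _ _ _ _ f hf s t hst
  have h := congrArg (BalancedTensor.rid R Y) hst
  rw [BalancedTensor.rid_map, BalancedTensor.rid_map] at h
  rw [← BalancedTensor.mk_rid_tmul_one R X s, ← BalancedTensor.mk_rid_tmul_one R X t, hf h]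

theorem PPFormula.IsLow.solutions_self {R : Type u} [Ring R] {φ : PPFormula R 1} (h : φ.IsLow) :
    φ.solutions R = {0} :=
  h R (isFlatModule_self R)

/-! ### Elementary duality -/

/-- The left formula `∃ z (x = D z ∧ C z = 0)` dual to the right formula `∃ y (y C = x D)`. -/
def PPFormula.dual {R : Type u} [Ring R] (ψ : PPFormula Rᵐᵒᵖ 1) : PPFormula R 1 where
  rows := ψ.bound + 1
  bound := ψ.rows
  A := Fin.cons (fun i => (ψ.B i 0).unop) (fun j i => (ψ.A i j).unop)
  B := Fin.cons (fun _ => 1) (fun _ _ => 0)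

theorem PPFormula.mem_dual_solutions_iff {R : Type u} [Ring R] (ψ : PPFormula Rᵐᵒᵖ 1)
    {M : Type v} [AddCommGroup M] [Module R M] {a : M} :
    a ∈ ψ.dual.solutions M ↔ ∃ z : Fin ψ.rows → M, ∑ i, (ψ.B i 0).unop • z i = a ∧
      ∀ j, ∑ i, (ψ.A i j).unop • z i = 0 := by
  rw [PPFormula.mem_solutions_iff]
  refine exists_congr fun z => ?_
  change (∀ k : Fin (ψ.bound + 1), _) ↔ _
  rw [Fin.forall_fin_succ]
  simp only [PPFormula.dual, Fin.cons_zero, Fin.cons_succ, one_smul, zero_smul]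
  rfl

/-- In an injective right module containing `R`, highness gives `y C = 1 D`. If `s = D z` and `C z =
0`, then `1 s = 1 D z = y C z = 0`. -/
theorem PPFormula.IsHigh.dual_solutions_self {R : Type u} [Ring R] {ψ : PPFormula Rᵐᵒᵖ 1}
    (h : ψ.IsHigh) {s : R} (hs : s ∈ ψ.dual.solutions R) : s = 0 := by
  obtain ⟨E, _, _, i, hi, hE⟩ := Module.exists_injective_embedding Rᵐᵒᵖ Rᵐᵒᵖ
  have h1 : i 1 ∈ ψ.solutions E := by rw [h E (hE.isAbsolutelyPure)]; trivial
  obtain ⟨y, hy⟩ := ψ.mem_solutions_iff.1 h1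
  obtain ⟨z, hz, hz0⟩ := ψ.mem_dual_solutions_iff.1 hs
  have key : i (MulOpposite.op s) = 0 := by
    calc i (MulOpposite.op s) = MulOpposite.op s • i 1 := by rw [← map_smul]; simp
      _ = ∑ k, (MulOpposite.op (z k) * ψ.B k 0) • i 1 := by
          rw [← hz, ← Finset.sum_smul]; simp
      _ = ∑ k, ∑ j, (MulOpposite.op (z k) * ψ.A k j) • y j := by
          simp_rw [mul_smul, ← hy, Finset.smul_sum]
      _ = ∑ j, (∑ k, MulOpposite.op (z k) * ψ.A k j) • y j := by
          rw [Finset.sum_comm]; simp_rw [Finset.sum_smul]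
      _ = 0 := by
          refine Finset.sum_eq_zero fun j _ => ?_
          have : ∑ k, MulOpposite.op (z k) * ψ.A k j = 0 := by
            apply MulOpposite.unop_injective
            simpa using hz0 j
          rw [this, zero_smul]
  exact MulOpposite.op_injective (hi (by simpa using key))

/-- A solution `z` for `q` is adjoined freely to `N`, as generators subject to `D z = q` and `C z =
0`. The hypothesis on `ψ` is what keeps `N` embedded, and purity then brings a solution back to `N`.
-/
theorem PPFormula.dual_solutions_eq_univ {R : Type u} [Ring R] {ψ : PPFormula Rᵐᵒᵖ 1}
    (h : ψ.solutions Rᵐᵒᵖ = {0}) (N : Type u) [AddCommGroup N] [Module R N]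
    (hN : IsAbsolutelyPure R N) : ψ.dual.solutions N = Set.univ := by
  refine Set.eq_univ_of_forall fun q => ?_
  let c : R →ₗ[R] N × (Fin ψ.rows → R) :=
    LinearMap.toSpanSingleton R _ (-q, fun i => (ψ.B i 0).unop)
  let d : (Fin ψ.bound → R) →ₗ[R] N × (Fin ψ.rows → R) :=
    Fintype.linearCombination R fun j => ((0 : N), fun i => (ψ.A i j).unop)
  let P := LinearMap.range (c.coprod d)
  let g : N →ₗ[R] (N × (Fin ψ.rows → R)) ⧸ P := P.mkQ ∘ₗ LinearMap.inl R N _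
  have hg : Function.Injective g := by
    rw [injective_iff_map_eq_zero]
    intro n hn
    have hn' : (n, (0 : Fin ψ.rows → R)) ∈ P := (Submodule.Quotient.mk_eq_zero P).1 hn
    obtain ⟨⟨r, y⟩, hry⟩ := hn'
    have h1 : -(r • q) = n := by
      simpa [c, d, Fintype.linearCombination_apply, Prod.fst_sum] using congrArg Prod.fst hry
    have h2 : ∀ i, r * (ψ.B i 0).unop + ∑ j, y j * (ψ.A i j).unop = 0 := by
      intro i
      simpa [c, d, Fintype.linearCombination_apply, Prod.snd_sum] using
        congrFun (congrArg Prod.snd hry) i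
    -- The generator coordinates say `r D + y C = 0`, so `-y` witnesses `ψ` at `r`.
    have hr : MulOpposite.op r ∈ ψ.solutions Rᵐᵒᵖ := by
      refine ψ.mem_solutions_iff.2 ⟨fun j => MulOpposite.op (-y j), fun i => ?_⟩
      apply MulOpposite.unop_injective
      simpa using neg_eq_of_add_eq_zero_left (h2 i)
    rw [h] at hr
    have hr0 : r = 0 := by simpa using hr
    simpa [hr0] using h1.symm
  refine (hN _ g hg).2 1 ψ.dual (fun _ => q) ?_
  change g q ∈ ψ.dual.solutions _
  have hsum : ∀ v : Fin ψ.rows → R, ∑ i, v i • P.mkQ ((0 : N), Pi.single i (1 : R)) =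
      P.mkQ (0, v) := by
    intro v
    rw [pi_eq_sum_univ' v]
    simp_rw [← map_smul, ← map_sum]
    congr 1
    ext <;> simp [Prod.fst_sum, Prod.snd_sum, Pi.single_apply]
  refine ψ.mem_dual_solutions_iff.2
    ⟨fun i => P.mkQ ((0 : N), Pi.single i (1 : R)), ?_, fun j => ?_⟩
  · rw [hsum fun i => (ψ.B i 0).unop]
    refine (Submodule.Quotient.eq P).2 ⟨(1, 0), ?_⟩
    simp [c]
  · rw [hsum fun i => (ψ.A i j).unop]
    refine (Submodule.Quotient.mk_eq_zero P).2 ⟨(0, Pi.single j 1), ?_⟩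
    simp [d]

/-! ### Rational extensions -/

/-- If `s` serves the tail, rationality for the pair `y 0 * s`, `s` yields `t` with `s * t ≠ 0` and
`y 0 * s * t` in `R`; right multiplication by `t` keeps the tail in `R`. -/
theorem IsRationalExtension.exists_common_denominator {R Q : Type u} [Ring R] [Nontrivial R]
    [Ring Q] {f : R →+* Q} (hf : IsRationalExtension (RestrictAlong.rightMap f)) :
    ∀ (n : ℕ) (y : Fin n → Q), ∃ s : R, s ≠ 0 ∧ ∀ j, ∃ r, f r = y j * f s := by
  have hinj : Function.Injective f := hf.1
  intro n
  induction n with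
  | zero => exact fun y => ⟨1, one_ne_zero, fun j => j.elim0⟩
  | succ n ih =>
    intro y
    obtain ⟨s, hs, h⟩ := ih (fun j => y j.succ)
    obtain ⟨t, ht, r, hr⟩ := hf.2 (y 0 * f s : Q) (f s : Q)
      (fun h0 => hs (hinj (h0.trans f.map_zero.symm)))
    change (f s * f t : Q) ≠ 0 at ht
    change f r = y 0 * f s * f t at hr
    refine ⟨s * t, fun h0 => ht (by rw [← f.map_mul, h0, f.map_zero]), fun j => ?_⟩
    refine Fin.cases ⟨r, by rw [hr, f.map_mul, mul_assoc]⟩ (fun j => ?_) j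
    obtain ⟨r', hr'⟩ := h j
    exact ⟨r' * t, by rw [f.map_mul, hr', f.map_mul, mul_assoc]⟩

/-- If `1` satisfies a left pp formula in a rational extension `Q` of `R`, then the formula has a
nonzero solution in `R`. -/
theorem IsRationalExtension.exists_ne_zero_mem_solutions {R Q : Type u} [Ring R] [Nontrivial R]
    [Ring Q] {f : R →+* Q} (hf : IsRationalExtension (RestrictAlong.rightMap f))
    {φ : PPFormula R 1} (h : RestrictAlong.rightMap f 1 ∈ φ.solutions (RestrictAlong f)) :
    ∃ s ∈ φ.solutions R, s ≠ 0 := by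
  obtain ⟨y, hy⟩ : ∃ y : Fin φ.bound → Q, ∀ i, ∑ j, f (φ.A i j) * y j = f (φ.B i 0) * f 1 :=
    φ.mem_solutions_iff.1 h
  obtain ⟨s, hs, hr⟩ := hf.exists_common_denominator _ y
  choose r hr using hr
  -- The system solved by `y` at `1` is multiplied by `s` on the right.
  refine ⟨s, φ.mem_solutions_iff.2 ⟨r, fun i => hf.1 ?_⟩, hs⟩
  change f _ = f _
  simp only [smul_eq_mul, map_sum, map_mul, hr, ← mul_assoc, ← Finset.sum_mul, hy, map_one, mul_one]

theorem hasNoHighLowFormula_of_isRationalExtension {R Q : Type u} [Ring R] [Nontrivial R]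
    [Ring Q] (f : R →+* Q) (hf : IsRationalExtension (RestrictAlong.rightMap f))
    (hQ : IsAbsolutelyPure R (RestrictAlong f)) : HasNoHighLowFormula R := by
  refine ⟨fun φ hφ => ?_, fun ψ hψ => ?_⟩
  · obtain ⟨s, hs, hs0⟩ := hf.exists_ne_zero_mem_solutions (φ := φ) (by rw [hφ.1 _ hQ]; trivial)
    rw [hφ.2.solutions_self] at hs
    exact hs0 hs
  · obtain ⟨s, hs, hs0⟩ := hf.exists_ne_zero_mem_solutions (φ := ψ.dual)
      (by rw [PPFormula.dual_solutions_eq_univ hψ.2.solutions_self _ hQ]; trivial)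
    exact hs0 (hψ.1.dual_solutions_self hs)

/-! ### Essential submodules and nonsingular modules -/

/-- If `K` misses the preimage, then `f(K)` misses `L`, so `f(K) = 0`; hence `K` lies in the kernel,
which is inside the preimage. -/
theorem IsEssentialSubmodule.comap {S : Type u} [Ring S] {M : Type v} {N : Type w}
    [AddCommGroup M] [Module S M] [AddCommGroup N] [Module S N] {L : Submodule S N}
    (hL : IsEssentialSubmodule L) (f : M →ₗ[S] N) : IsEssentialSubmodule (L.comap f) := by
  intro K hK
  have hmap : K.map f = ⊥ := by
    refine hL _ ((Submodule.eq_bot_iff _).2 ?_)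
    rintro _ ⟨hxL, x, hx, rfl⟩
    have : x ∈ L.comap f ⊓ K := ⟨hxL, hx⟩
    rw [hK, Submodule.mem_bot] at this
    rw [this, map_zero]
  rw [← hK, eq_comm, inf_eq_right]
  intro x hx
  have : f x ∈ K.map f := Submodule.mem_map_of_mem hx
  rw [hmap, Submodule.mem_bot] at this
  simp [this]

theorem IsEssentialSubmodule.mono {S : Type u} [Ring S] {M : Type v} [AddCommGroup M]
    [Module S M] {L L' : Submodule S M} (hL : IsEssentialSubmodule L) (h : L ≤ L') :
    IsEssentialSubmodule L' :=
  fun K hK => hL K (le_bot_iff.1 (hK ▸ inf_le_inf_right K h))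

theorem IsEssentialSubmodule.exists_smul_mem {S : Type u} [Ring S] {M : Type v} [AddCommGroup M]
    [Module S M] {L : Submodule S M} (hL : IsEssentialSubmodule L) {x : M} (hx : x ≠ 0) :
    ∃ s : S, s • x ≠ 0 ∧ s • x ∈ L := by
  by_contra! hcon
  refine hx ?_
  have h := hL (S ∙ x) ((Submodule.eq_bot_iff _).2 ?_)
  · simpa using h
  · rintro _ ⟨hy, hy'⟩
    obtain ⟨s, rfl⟩ := Submodule.mem_span_singleton.1 hy'
    by_contra h0
    exact hcon s h0 hy

/-- An essential extension of a nonsingular module is nonsingular. -/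
theorem IsNonsingularModule.of_essential {S : Type u} [Ring S] {A : Type v} {E : Type w}
    [AddCommGroup A] [Module S A] [AddCommGroup E] [Module S E] (hA : IsNonsingularModule S A)
    (f : A →ₗ[S] E) (hf : Function.Injective f)
    (hess : IsEssentialSubmodule (LinearMap.range f)) : IsNonsingularModule S E := by
  intro x hx hxess
  obtain ⟨s, hs, a, ha⟩ := hess.exists_smul_mem hx
  refine hA a (fun h => hs (by rw [← ha, h, map_zero])) ?_
  -- Since `f a = s • x`, any `t` with `t * s` annihilating `x` annihilates `a`.
  refine (hxess.comap (LinearMap.toSpanSingleton S S s)).mono fun t ht => ?_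
  rw [Ideal.mem_torsionOf_iff]
  apply hf
  rw [map_smul, ha, map_zero, ← mul_smul]
  exact ht

/-- The `s` with `b₀ s ∈ R` form an essential right ideal; were rationality to fail, it would
annihilate `b₁ ≠ 0`, although `Q` is nonsingular. -/
theorem IsMaximalRightQuotientRing.isRationalExtension {R Q : Type u} [Ring R] [Ring Q]
    {f : R →+* Q} (hR : IsRightNonsingular R) (hf : IsMaximalRightQuotientRing f) :
    IsRationalExtension (RestrictAlong.rightMap f) := by
  obtain ⟨hinj, hess, -⟩ := hf
  refine ⟨hinj, fun b₀ b₁ hb => ?_⟩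
  have hns := hR.of_essential _ hinj hess
  by_contra! hcon
  refine hns b₁ hb ((hess.comap (LinearMap.toSpanSingleton Rᵐᵒᵖ _ b₀)).mono fun s hs => ?_)
  rw [Ideal.mem_torsionOf_iff]
  by_contra h0
  exact hcon s.unop h0 hs

/-! ### Commutative rings -/

/-- If `x² = 0`, the annihilator of `x` is essential: for `a` in an ideal `K` meeting it trivially,
`x * a` lies in both, so `x * a = 0`, and then `a` lies in both. -/
theorem isReduced_of_isNonsingularModule {R : Type u} [CommRing R]
    (h : IsNonsingularModule R R) : IsReduced R := by
  rw [isReduced_iff_pow_one_lt 2 one_lt_two]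
  intro x hx
  by_contra hx0
  refine h x hx0 fun K hK => (Submodule.eq_bot_iff _).2 fun a ha => ?_
  have hax : x * a ∈ Ideal.torsionOf R R x ⊓ K :=
    ⟨(Ideal.mem_torsionOf_iff x _).2 (by rw [smul_eq_mul, mul_right_comm, ← sq, hx, zero_mul]),
      K.smul_mem x ha⟩
  rw [hK, Submodule.mem_bot] at hax
  have haK : a ∈ Ideal.torsionOf R R x ⊓ K :=
    ⟨(Ideal.mem_torsionOf_iff x _).2 (by rw [smul_eq_mul, mul_comm, hax]), ha⟩
  rwa [hK, Submodule.mem_bot] at haK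

/-- A localization that is a field is absolutely pure. -/
theorem isAbsolutelyPure_of_isLocalization {R K : Type u} [CommRing R] [Field K] [Algebra R K]
    (S : Submonoid R) [IsLocalization S K] : IsAbsolutelyPure R K := by
  intro N _ _ f hf
  -- `x ↦ 1 ⊗ f x` is an injective map of `K`-vector spaces, hence splits; its retraction composed
  -- with `n ↦ 1 ⊗ n` retracts `f`.
  let h : K →ₗ[K] TensorProduct R K N :=
    LinearMap.extendScalarsOfIsLocalization S K (TensorProduct.mk R K N 1 ∘ₗ f)
  have hh : LinearMap.ker h = ⊥ := by
    refine LinearMap.ker_eq_bot'.2 fun x hx => ?_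
    obtain ⟨s, hs⟩ := (IsLocalizedModule.eq_zero_iff S (TensorProduct.mk R K N 1)).1
      (show TensorProduct.mk R K N 1 (f x) = 0 from hx)
    have hsx : (s : R) • x = 0 := hf (by rw [map_smul, map_zero]; exact hs)
    rw [Algebra.smul_def] at hsx
    exact (mul_eq_zero.1 hsx).resolve_left (IsLocalization.map_units K s).ne_zero
  obtain ⟨g, hg⟩ := h.exists_leftInverse_of_injective hh
  exact .of_leftInverse f (g.restrictScalars R ∘ₗ TensorProduct.mk R K N 1)
    fun x => LinearMap.congr_fun hg x

/-- If `1` satisfies a pp formula in a localization at `S`, then some element of `S` satisfies it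
in the ring. -/
theorem PPFormula.exists_mem_solutions_of_isLocalization {R K : Type u} [CommRing R] [CommRing K]
    [Algebra R K] (S : Submonoid R) [IsLocalization S K] {φ : PPFormula R 1}
    (h : (1 : K) ∈ φ.solutions K) : ∃ s ∈ S, s ∈ φ.solutions R := by
  obtain ⟨y, hy⟩ := φ.mem_solutions_iff.1 h
  obtain ⟨t, ht⟩ := IsLocalization.exist_integer_multiples_of_finite S y
  choose r hr using ht
  have heq : ∀ i, algebraMap R K (∑ j, φ.A i j * r j) = algebraMap R K (φ.B i 0 * t) := by
    intro i
    have := congrArg (fun z => (t : R) • z) (hy i)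
    simp only [Finset.smul_sum, smul_comm (t : R), ← hr] at this
    simpa [Algebra.smul_def, mul_comm] using this
  -- Each equation descends to `R` only after multiplication by some `c i ∈ S`; the product of these
  -- serves all rows at once.
  choose c hc using fun i => IsLocalization.exists_of_eq (M := S) (heq i)
  refine ⟨(∏ i, (c i : R)) * t, S.mul_mem (S.prod_mem fun i _ => (c i).2) t.2,
    φ.mem_solutions_iff.2 ⟨fun j => (∏ i, (c i : R)) * r j, fun i => ?_⟩⟩
  obtain ⟨d, hd⟩ := Finset.dvd_prod_of_mem (fun i => (c i : R)) (Finset.mem_univ i)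
  calc ∑ j, φ.A i j • ((∏ i, (c i : R)) * r j) = d * (c i * ∑ j, φ.A i j * r j) := by
        simp only [hd, Finset.mul_sum, smul_eq_mul]
        exact Finset.sum_congr rfl fun j _ => by ring
    _ = φ.B i 0 • ((∏ i, (c i : R)) * t) := by
        rw [hc, hd, smul_eq_mul]; ring

/-- By minimality of `p` the maximal ideal of the localization is its nilradical, which is zero
because reducedness localizes. -/
theorem Localization.AtPrime.isField_of_mem_minimalPrimes {R : Type u} [CommRing R] [IsReduced R]
    (p : Ideal R) [p.IsPrime] (hp : p ∈ minimalPrimes R) : IsField (Localization.AtPrime p) := by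
  rw [IsLocalRing.isField_iff_maximalIdeal_eq, ← Localization.AtPrime.map_eq_maximalIdeal,
    ← IsLocalization.AtPrime.radical_map_of_mem_minimalPrimes _ p ⊥ hp, Ideal.map_bot]
  exact nilradical_eq_bot_iff.2 inferInstance

theorem PPFormula.not_isHighLow_of_isReduced {R : Type u} [CommRing R] [Nontrivial R]
    [IsReduced R] (φ : PPFormula R 1) : ¬ φ.IsHighLow := by
  intro hφ
  obtain ⟨p, hp⟩ := Ideal.nonempty_minimalPrimes (bot_ne_top (α := Ideal R))
  have : p.IsPrime := hp.1.1
  let := (Localization.AtPrime.isField_of_mem_minimalPrimes p hp).toField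
  obtain ⟨s, hs, hsφ⟩ := PPFormula.exists_mem_solutions_of_isLocalization
    (K := Localization.AtPrime p) p.primeCompl (φ := φ)
    (by rw [hφ.1 _ (isAbsolutelyPure_of_isLocalization p.primeCompl)]; trivial)
  rw [hφ.2.solutions_self] at hsφ
  exact hs (by rw [Set.mem_singleton_iff.1 hsφ]; exact p.zero_mem)

theorem hasNoHighLowFormula_of_isReduced (R : Type u) [CommRing R] [Nontrivial R] [IsReduced R] :
    HasNoHighLowFormula R :=
  have : IsReduced Rᵐᵒᵖ := ⟨fun x ⟨n, hn⟩ => MulOpposite.unop_injective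
    (IsReduced.eq_zero x.unop ⟨n, by rw [← MulOpposite.unop_pow, hn, MulOpposite.unop_zero]⟩)⟩
  ⟨PPFormula.not_isHighLow_of_isReduced, PPFormula.not_isHighLow_of_isReduced⟩

theorem mainTheorem10 :
    (∀ (R Q : Type u) [Ring R] [Nontrivial R] [Ring Q] (f : R →+* Q),
      IsRationalExtension (RestrictAlong.rightMap f) →
      IsAbsolutelyPure R (RestrictAlong f) →
      HasNoHighLowFormula R) ∧
    (∀ (R Q : Type u) [Ring R] [Nontrivial R] [Ring Q] (f : R →+* Q),
      IsRightNonsingular R →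
      IsMaximalRightQuotientRing f →
      IsAbsolutelyPure R (RestrictAlong f) →
      HasNoHighLowFormula R) ∧
    (∀ (R : Type u) [CommRing R] [Nontrivial R],
      IsNonsingularModule R R →
      HasNoHighLowFormula R) := by
  refine ⟨fun R Q _ _ _ f hf hQ => hasNoHighLowFormula_of_isRationalExtension f hf hQ,
    fun R Q _ _ _ f hR hf hQ =>
      hasNoHighLowFormula_of_isRationalExtension f (hf.isRationalExtension hR) hQ,
    fun R _ _ hR => ?_⟩
  have := isReduced_of_isNonsingularModule hR
  exact hasNoHighLowFormula_of_isReduced R
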